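/- A semimeasure on the binary tree is a function $a:\{0,1\}^*\to[0,\infty)$ with $a(\Lambda)\le 1$ for the empty string $\Lambda$ and $a(x0)+a(x1)\le a(x)$ for every finite binary string $x$. A real-valued function is lower semicomputable (respectively, lower $\mathbf{0}'$-semicomputable) if it is the pointwise limit of a non-decreasing sequence of rational-valued functions computed, uniformly in the index and the argument, by an algorithm (respectively, by an algorithm with oracle $\mathbf{0}'$, the universal enumerable set). Let $m(x|n)$, where $x\in\{0,1\}^*$ and $n\in\mathbb{N}$, be a maximal conditional lower semicomputable semimeasure on the binary tree. That is, $(x,n)\mapsto m(x|n)$ is lower semicomputable, $x\mapsto m(x|n)$ is a semimeasure on the binary tree for every $n$, and for every other function $a(x|n)$ with these two properties there is a constant $c>0$ such that $a(x|n)\le c\,m(x|n)$ for all $x$ and $n$. Let $m^{\mathbf{0}'}(x)$ be a maximal (up to a constant factor) lower $\mathbf{0}'$-semicomputable semimeasure on the binary tree. Define the a priori complexities $\mathit{KA}(x|n)=-\log_2 m(x|n)$ and $\mathit{KA}^{\mathbf{0}'}(x)=-\log_2 m^{\mathbf{0}'}(x)$. Then $$\limsup_{n\to\infty}\mathit{KA}(x|n)=\mathit{KA}^{\mathbf{0}'}(x)+O(1),$$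 that is, there is a constant $c$ such that for all binary strings $x$ the two sides $\limsup_{n\to\infty}\mathit{KA}(x|n)$ and $\mathit{KA}^{\mathbf{0}'}(x)$ differ by at most $c$. -/

import Mathlib

open Filter Topology

/-- The universal enumerable set `0'`: the pairs (program, input) for which the computation
halts, coded by natural numbers. -/
def haltingSet : Set ℕ :=
  {p | (Nat.Partrec.Code.eval (Denumerable.ofNat Nat.Partrec.Code p.unpair.1) p.unpair.2).Dom}

open Classical in
/-- The (total) characteristic function of `0'`. -/
noncomputable def haltingFun : ℕ → ℕ := fun p => if p ∈ haltingSet then 1 else 0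

/-- The oracle `0'`, as a set of oracle functions. -/
noncomputable def haltingOracle : Set (ℕ →. ℕ) := {(haltingFun : ℕ →. ℕ)}

/-- A total rational-valued function is computable with oracles in `O`: it has the form
`(u - v) / (d + 1)` where `u`, `v`, `d` are `O`-computable functions with values in `ℕ`. -/
def ComputableRatIn {α : Type} [Primcodable α] (O : Set (ℕ →. ℕ)) (q : α → ℚ) : Prop :=
  ∃ u v d : α → ℕ, ComputableIn O u ∧ ComputableIn O v ∧ ComputableIn O d ∧
    ∀ x, q x = ((u x : ℚ) - (v x : ℚ)) / ((d x : ℚ) + 1)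

/-- `a` is lower semicomputable relative to `O`: it is the pointwise limit of a non-decreasing
`O`-computable sequence of total rational-valued functions. With `O = ∅` this is
(unrelativized) lower semicomputability. -/
def LowerSemicomputableIn {α : Type} [Primcodable α] (O : Set (ℕ →. ℕ)) (a : α → ℝ) : Prop :=
  ∃ q : α → ℕ → ℚ, ComputableRatIn O (fun p : α × ℕ => q p.1 p.2) ∧
    ∀ x, Monotone (q x) ∧ Tendsto (fun k => (q x k : ℝ)) atTop (𝓝 (a x))

/-- Semimeasures on the binary tree. A vertex is a finite binary string `x`, its children are
`x0` and `x1`, the root is the empty string. -/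
structure IsTreeSemimeasure (a : List Bool → ℝ) : Prop where
  nonneg : ∀ x, 0 ≤ a x
  root_le_one : a [] ≤ 1
  children_le : ∀ x, a (x ++ [false]) + a (x ++ [true]) ≤ a x

/-- `a` is a semimeasure on the binary tree, lower semicomputable relative to `O`. -/
def IsLscTreeSemimeasure (O : Set (ℕ →. ℕ)) (a : List Bool → ℝ) : Prop :=
  IsTreeSemimeasure a ∧ LowerSemicomputableIn O a

/-- `m` is maximal, up to a constant factor, among the semimeasures on the binary tree that are
lower semicomputable relative to `O`. -/
def IsMaximalTreeSemimeasure (O : Set (ℕ →. ℕ)) (m : List Bool → ℝ) : Prop :=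
  IsLscTreeSemimeasure O m ∧
    ∀ a, IsLscTreeSemimeasure O a → ∃ c : ℝ, 0 < c ∧ ∀ x, a x ≤ c * m x

/-- A lower semicomputable family `a x n` (written `a(x|n)`) of semimeasures on the binary tree,
one for each condition `n`. Semicomputability is joint in `x` and `n`. -/
def IsLscCondTreeSemimeasure (a : List Bool → ℕ → ℝ) : Prop :=
  (∀ n, IsTreeSemimeasure (fun x => a x n)) ∧
    LowerSemicomputableIn ∅ (fun p : List Bool × ℕ => a p.1 p.2)

/-- `m` is a maximal lower semicomputable family of semimeasures on the binary tree: it dominates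
every other one up to a factor that does not depend on the string or on the condition. -/
def IsMaximalCondTreeSemimeasure (m : List Bool → ℕ → ℝ) : Prop :=
  IsLscCondTreeSemimeasure m ∧
    ∀ a, IsLscCondTreeSemimeasure a → ∃ c : ℝ, 0 < c ∧ ∀ x n, a x n ≤ c * m x n

/-- `-log₂ r` for `r ≥ 0`, with `-log₂ 0 = +∞`. -/
noncomputable def negLogTwo (r : ℝ) : EReal :=
  if r = 0 then ⊤ else ((-Real.logb 2 r : ℝ) : EReal)

/-- The a priori complexity `KA(x)` defined by the semimeasure `m` on the binary tree. -/
noncomputable def KA (m : List Bool → ℝ) (x : List Bool) : EReal :=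
  negLogTwo (m x)

/-- The conditional a priori complexity `KA(x|n)` defined by the family `m`. -/
noncomputable def KACond (m : List Bool → ℕ → ℝ) (x : List Bool) (n : ℕ) : EReal :=
  negLogTwo (m x n)

/-! Passing to semimeasures turns the limsup of complexities into a liminf of `m(x|n)` over `n`.
Each inequality is obtained by building a semimeasure and invoking maximality.

Upper bound on the limsup (`IsLscTreeSemimeasure.exists_cond`). Let `a` be lower
`0'`-semicomputable. By the limit lemma its rational lower bounds are limits of computable guesses.
At condition `n`, the first `n` guesses are rounded to multiples of `2⁻ⁿ` and accepted greedily
while the least superadditive function above the accepted ones stays at most `1` at the root. For a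
given `x`, once `n` is large, a good lower bound for `a x` and every earlier guess are correct; they
lie below `a`, so they are all accepted.

Lower bound (`IsLscCondTreeSemimeasure.exists_le`). Checking that `m(x|n)` exceeds a rational for
all `n ≥ N` is not evidently possible with `0'`. Instead, a request to raise `m(x|n)` to that
rational for all `n ≥ N` is granted whenever, together with earlier grants, it keeps the root at
most `1` at every condition and stage. This is a `Π₁` question, so `0'` answers it. A request
strictly below `m` changes nothing in the limit, hence is granted. Finitely many grants are all
active at large `n`, so the closure of all grants is a semimeasure, and it bounds the liminf from
above. -/

/-! ### Closure properties of oracle computability -/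

namespace ComputableIn

variable {α β γ σ : Type} [Primcodable α] [Primcodable β] [Primcodable γ] [Primcodable σ]
  {O : Set (ℕ →. ℕ)}

theorem comp {f : β → σ} {g : α → β} (hf : ComputableIn O f) (hg : ComputableIn O g) :
    ComputableIn O fun a => f (g a) :=
  (Nat.RecursiveIn.comp hf hg).of_eq fun n => by
    cases Encodable.decode (α := α) n <;> simp

theorem pair {f : α → β} {g : α → γ} (hf : ComputableIn O f) (hg : ComputableIn O g) :
    ComputableIn O fun a => (f a, g a) :=
  (Nat.RecursiveIn.pair hf hg).of_eq fun n => by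
    cases Encodable.decode (α := α) n <;> simp [Seq.seq]

theorem nat_rec {a : σ} {g : ℕ × σ → σ} (hg : ComputableIn O g) :
    ComputableIn O fun n : ℕ => Nat.rec (motive := fun _ => σ) a (fun y ih => g (y, ih)) n := by
  have hbase : Nat.RecursiveIn O (fun _ => Part.some (Encodable.encode a)) :=
    ((ComputableIn.const (α := ℕ) (O := O) (Encodable.encode a)) :
      RecursiveIn O _).of_eq (fun _ => rfl) |> RecursiveIn.iff_nat.1
  have hstep : Nat.RecursiveIn O _ := Nat.RecursiveIn.comp hg Nat.RecursiveIn.right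
  have hrec := Nat.RecursiveIn.prec hbase hstep
  have harg : Nat.RecursiveIn O (fun n => Part.some (Nat.pair 0 n)) :=
    RecursiveIn.iff_nat.1
      ((Primrec₂.natPair.comp (Primrec.const 0) Primrec.id).computableIn : ComputableIn O _)
  refine (Nat.RecursiveIn.comp hrec harg).of_eq fun n => ?_
  have key : ∀ k : ℕ, Nat.rec (motive := fun _ => Part ℕ) (Part.some (Encodable.encode a))
      (fun y IH => IH.bind fun i => Part.bind (Part.some (Nat.pair 0 (Nat.pair y i)).unpair.2)
        fun m => Part.bind (Encodable.decode (α := ℕ × σ) m) fun b =>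
          Part.map Encodable.encode (Part.some (g b))) k =
      Part.some (Encodable.encode
        (Nat.rec (motive := fun _ => σ) a (fun y ih => g (y, ih)) k)) := by
    intro k
    induction k with
    | zero => rfl
    | succ k ih =>
      dsimp only at ih ⊢
      rw [ih]
      simp
  simpa using! key n

theorem of_empty {f : α → σ} (hf : ComputableIn ∅ f) : Computable f :=
  recursiveIn_empty_iff.1 hf

end ComputableIn

theorem haltingFun_computableIn : ComputableIn haltingOracle haltingFun :=
  RecursiveIn.oracle _ rfl

/-! ### The limit lemma for `0'` -/

/-- A partial function is limit computable if its values are limits of a computable family. -/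
def LimitComputable (f : ℕ →. ℕ) : Prop :=
  ∃ F : ℕ → ℕ → ℕ, Computable₂ F ∧ ∀ x y, y ∈ f x → ∀ᶠ n in atTop, F x n = y

theorem LimitComputable.of_computable {f : ℕ → ℕ} (hf : Computable f) :
    LimitComputable (f : ℕ →. ℕ) := by
  refine ⟨fun x _ => f x, hf.comp Computable.fst, fun x y h => ?_⟩
  simp only [PFun.coe_val, Part.mem_some_iff] at h
  simp [h]

/-- Running the program for `n` steps gives a guess that changes at most once, from `0` to `1`. -/
theorem limitComputable_haltingFun : LimitComputable (haltingFun : ℕ →. ℕ) := by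
  refine ⟨fun p n => if (Nat.Partrec.Code.evaln n (Denumerable.ofNat Nat.Partrec.Code p.unpair.1)
    p.unpair.2).isSome then 1 else 0, ?_, ?_⟩
  · change Computable fun q : ℕ × ℕ => if (Nat.Partrec.Code.evaln q.2
      (Denumerable.ofNat Nat.Partrec.Code q.1.unpair.1) q.1.unpair.2).isSome then 1 else 0
    have hup : Primrec fun q : ℕ × ℕ => q.1.unpair := Primrec.unpair.comp Primrec.fst
    have hcode : Primrec fun q : ℕ × ℕ => Denumerable.ofNat Nat.Partrec.Code q.1.unpair.1 :=
      (Primrec.ofNat Nat.Partrec.Code).comp (Primrec.fst.comp hup)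
    have heval := Primrec.option_isSome.comp (Nat.Partrec.Code.primrec_evaln.comp
      ((Primrec.snd.pair hcode).pair (Primrec.snd.comp hup)))
    exact ((Primrec.cond heval (Primrec.const 1) (Primrec.const 0)).of_eq
      fun q => Bool.cond_eq_ite _ _ _).to_comp
  · intro p y hy
    simp only [PFun.coe_val, Part.mem_some_iff] at hy
    subst hy
    by_cases h : p ∈ haltingSet
    · obtain ⟨v, hv⟩ := Part.dom_iff_mem.1 h
      obtain ⟨k, hk⟩ := Nat.Partrec.Code.evaln_complete.1 hv
      filter_upwards [eventually_ge_atTop k] with n hn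
      have := Nat.Partrec.Code.evaln_mono hn hk
      rw [Option.mem_def] at this
      simp [haltingFun, h, this]
    · refine Eventually.of_forall fun n => ?_
      have : Nat.Partrec.Code.evaln n (Denumerable.ofNat Nat.Partrec.Code p.unpair.1)
          p.unpair.2 = none := by
        rw [Option.eq_none_iff_forall_not_mem]
        intro v hv
        exact h (Part.dom_iff_mem.2 ⟨v, Nat.Partrec.Code.evaln_sound hv⟩)
      simp [haltingFun, h, this]

namespace LimitComputable

variable {f g : ℕ →. ℕ}

theorem pair (hf : LimitComputable f) (hg : LimitComputable g) :
    LimitComputable fun n => Nat.pair <$> f n <*> g n := by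
  obtain ⟨F, hF, hFl⟩ := hf
  obtain ⟨G, hG, hGl⟩ := hg
  refine ⟨fun x n => Nat.pair (F x n) (G x n), Primrec₂.natPair.to_comp.comp hF hG, ?_⟩
  intro x y hy
  simp only [Seq.seq, Part.map_eq_map, Part.mem_bind_iff, Part.mem_map_iff] at hy
  obtain ⟨_, ⟨a, ha, rfl⟩, b, hb, rfl⟩ := hy
  filter_upwards [hFl x a ha, hGl x b hb] with n h1 h2
  rw [h1, h2]

theorem comp (hf : LimitComputable f) (hg : LimitComputable g) :
    LimitComputable fun n => g n >>= f := by
  obtain ⟨F, hF, hFl⟩ := hf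
  obtain ⟨G, hG, hGl⟩ := hg
  refine ⟨fun x n => F (G x n) n, hF.comp hG Computable.snd, ?_⟩
  intro x y hy
  obtain ⟨a, ha, hy⟩ := Part.mem_bind_iff.1 hy
  filter_upwards [hGl x a ha, hFl a y hy] with n h1 h2
  rw [h1, h2]

theorem prec (hf : LimitComputable f) (hg : LimitComputable g) :
    LimitComputable fun p =>
      (p.unpair.2.rec (f p.unpair.1) fun y IH => IH.bind fun i =>
        g (Nat.pair p.unpair.1 (Nat.pair y i)) : Part ℕ) := by
  obtain ⟨F, hF, hFl⟩ := hf
  obtain ⟨G, hG, hGl⟩ := hg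
  refine ⟨fun p n => Nat.rec (motive := fun _ => ℕ) (F p.unpair.1 n)
    (fun y i => G (Nat.pair p.unpair.1 (Nat.pair y i)) n) p.unpair.2, ?_, ?_⟩
  · have hup : Computable fun q : ℕ × ℕ => q.1.unpair := Computable.unpair.comp Computable.fst
    have hstep : Computable₂ fun (q : ℕ × ℕ) (r : ℕ × ℕ) =>
        G (Nat.pair q.1.unpair.1 (Nat.pair r.1 r.2)) q.2 := by
      refine hG.comp (Primrec₂.natPair.to_comp.comp
        (Computable.fst.comp (hup.comp Computable.fst)) ?_) (Computable.snd.comp Computable.fst)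
      exact Primrec₂.natPair.to_comp.comp (Computable.fst.comp Computable.snd)
        (Computable.snd.comp Computable.snd)
    exact Computable.nat_rec (f := fun q : ℕ × ℕ => q.1.unpair.2)
      (g := fun q => F q.1.unpair.1 q.2)
      (h := fun q r => G (Nat.pair q.1.unpair.1 (Nat.pair r.1 r.2)) q.2) (Computable.snd.comp hup)
      (hF.comp (Computable.fst.comp hup) Computable.snd) hstep
  · intro p
    dsimp only
    induction p.unpair.2 with
    | zero => exact fun y hy => hFl _ _ hy
    | succ k ih =>
      intro y hy
      obtain ⟨i, hi, hy⟩ := Part.mem_bind_iff.1 hy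
      filter_upwards [ih i hi, hGl _ _ hy] with n h1 h2
      rw [h1, h2]

theorem rfind (hf : LimitComputable f) :
    LimitComputable fun a => Nat.rfind fun n =>
      ((f (Nat.pair a n)).map fun m => decide (m = 0) : Part Bool) := by
  obtain ⟨F, hF, hFl⟩ := hf
  -- The search is truncated to `n` steps: the counter advances until the `n`-th guess vanishes.
  -- Once the guesses at `0, …, y` have settled and `n ≥ y`, it stops at `y`.
  refine ⟨fun a n => Nat.rec (motive := fun _ => ℕ) 0
    (fun _ s => if F (Nat.pair a s) n = 0 then s else s + 1) n, ?_, ?_⟩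
  · have hs : Computable fun q : (ℕ × ℕ) × ℕ × ℕ => q.2.2 := Computable.snd.comp Computable.snd
    have hz : Computable fun q : (ℕ × ℕ) × ℕ × ℕ =>
        decide (F (Nat.pair q.1.1 q.2.2) q.1.2 = 0) :=
      (Primrec.eq (α := ℕ)).decide.to_comp.comp
        (hF.comp (Primrec₂.natPair.to_comp.comp (Computable.fst.comp Computable.fst) hs)
          (Computable.snd.comp Computable.fst)) (Computable.const 0)
    have hstep : Computable₂ fun (q : ℕ × ℕ) (r : ℕ × ℕ) =>
        if F (Nat.pair q.1 r.2) q.2 = 0 then r.2 else r.2 + 1 :=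
      (Computable.cond hz hs (Computable.succ.comp hs)).of_eq fun q => by
        by_cases h : F (Nat.pair q.1.1 q.2.2) q.1.2 = 0 <;> simp [h]
    exact Computable.nat_rec Computable.snd (Computable.const 0) hstep
  · intro a y hy
    obtain ⟨hy, hlt⟩ := Nat.mem_rfind.1 hy
    obtain ⟨v, hv, hv0⟩ := (Part.mem_map_iff _).1 hy
    obtain rfl : v = 0 := of_decide_eq_true hv0
    have hev : ∀ᶠ n in atTop, ∀ j ∈ Finset.range y, F (Nat.pair a j) n ≠ 0 := by
      rw [Filter.eventually_all_finset]
      intro j hj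
      obtain ⟨w, hw, hw0⟩ := (Part.mem_map_iff _).1 (hlt (Finset.mem_range.1 hj))
      filter_upwards [hFl _ _ hw] with n hn
      rw [hn]; exact of_decide_eq_false hw0
    filter_upwards [hev, hFl _ _ hv, eventually_ge_atTop y] with n h1 h2 h3
    have key : ∀ i, Nat.rec (motive := fun _ => ℕ) 0
        (fun _ s => if F (Nat.pair a s) n = 0 then s else s + 1) i = min i y := by
      intro i
      induction i with
      | zero => simp
      | succ i ih =>
        dsimp only at ih ⊢
        rw [ih]
        rcases lt_or_ge i y with h | h
        · rw [min_eq_left h.le, if_neg (h1 i (Finset.mem_range.2 h)), min_eq_left h]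
        · rw [min_eq_right h, if_pos h2, min_eq_right (by omega)]
    rw [key, min_eq_right h3]

/-- A convergent computation uses only finitely many intermediate values, so their guesses settle
simultaneously. Nothing is required where `f` is undefined, which lets partial functions pass
through the induction. -/
theorem of_recursiveIn (hf : Nat.RecursiveIn haltingOracle f) : LimitComputable f := by
  induction hf with
  | zero => exact of_computable (f := fun _ => 0) (Computable.const 0)
  | succ => exact of_computable Computable.succ
  | left => exact of_computable (Computable.fst.comp Computable.unpair)
  | right => exact of_computable (Computable.snd.comp Computable.unpair)
  | oracle g hg =>
    rw [Set.mem_singleton_iff.1 hg]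
    exact limitComputable_haltingFun
  | pair _ _ h1 h2 => exact h1.pair h2
  | comp _ _ h1 h2 => exact h1.comp h2
  | prec _ _ h1 h2 => exact h1.prec h2
  | rfind _ h => exact h.rfind

end LimitComputable

/-- The limit lemma: a function computable in the halting problem is the pointwise eventual value
of a computable family. -/
theorem ComputableIn.exists_limit_approximation {α : Type} [Primcodable α] {f : α → ℕ}
    (hf : ComputableIn haltingOracle f) :
    ∃ F : α → ℕ → ℕ, Computable₂ F ∧ ∀ a, ∀ᶠ n in atTop, F a n = f a := by
  obtain ⟨F, hF, hlim⟩ := LimitComputable.of_recursiveIn hf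
  refine ⟨fun a n => F (Encodable.encode a) n,
    hF.comp (Computable.encode.comp Computable.fst) Computable.snd, fun a => hlim _ _ ?_⟩
  simp

/-! ### Superadditive closure on the binary tree -/

/-- The position of a binary string in the heap order: the root is `0`, and the children of `h`
are `2 * h + 1` and `2 * h + 2`. -/
def heapIndex (x : List Bool) : ℕ :=
  x.foldl (fun h b => 2 * h + 1 + b.toNat) 0

@[simp]
theorem heapIndex_nil : heapIndex [] = 0 := rfl

theorem heapIndex_concat (x : List Bool) (b : Bool) :
    heapIndex (x ++ [b]) = 2 * heapIndex x + 1 + b.toNat := by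
  simp [heapIndex]

theorem heapIndex_injective : Function.Injective heapIndex := by
  intro x
  induction x using List.reverseRecOn with
  | nil =>
    intro y hy
    rcases List.eq_nil_or_concat' y with rfl | ⟨y, c, rfl⟩
    · rfl
    · rw [heapIndex_concat, heapIndex_nil] at hy; omega
  | append_singleton x b ih =>
    intro y hy
    rcases List.eq_nil_or_concat' y with rfl | ⟨y, c, rfl⟩
    · rw [heapIndex_concat, heapIndex_nil] at hy; omega
    · rw [heapIndex_concat, heapIndex_concat] at hy
      have hb : b = c := by
        cases b <;> cases c <;> simp at hy ⊢ <;> omega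
      subst hb
      rw [ih (by omega : heapIndex x = heapIndex y)]

theorem primrec_heapIndex : Primrec heapIndex := by
  have hstep : Primrec₂ fun (_ : List Bool) (p : ℕ × Bool) => 2 * p.1 + 1 + p.2.toNat := by
    refine Primrec.nat_add.comp ?_ ((Primrec.dom_bool Bool.toNat).comp
      (Primrec.snd.comp Primrec.snd))
    exact Primrec.nat_double_succ.comp (Primrec.fst.comp Primrec.snd)
  exact Primrec.list_foldl Primrec.id (Primrec.const 0) hstep

/-- The largest value that a finite list of pairs `(node, value)` assigns to the node `h`. -/
def entryMax (e : List (ℕ × ℕ)) (h : ℕ) : ℕ :=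
  e.foldr (fun p s => max (if p.1 = h then p.2 else 0) s) 0

theorem le_entryMax {e : List (ℕ × ℕ)} {h v : ℕ} (hv : (h, v) ∈ e) : v ≤ entryMax e h := by
  induction e with
  | nil => simp at hv
  | cons p e ih =>
    rw [entryMax, List.foldr_cons, ← entryMax]
    rcases List.mem_cons.1 hv with rfl | hv
    · simp
    · exact le_max_of_le_right (ih hv)

theorem entryMax_eq_zero_or_mem (e : List (ℕ × ℕ)) (h : ℕ) :
    entryMax e h = 0 ∨ (h, entryMax e h) ∈ e := by
  induction e with
  | nil => exact Or.inl rfl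
  | cons p e ih =>
    rw [entryMax, List.foldr_cons, ← entryMax]
    rcases max_choice (if p.1 = h then p.2 else 0) (entryMax e h) with hm | hm <;> rw [hm]
    · split_ifs with hp
      · subst hp; simp
      · exact Or.inl rfl
    · exact ih.imp id (List.mem_cons_of_mem _)

theorem mul_entryMax_le {c : ℕ} {e e' : List (ℕ × ℕ)}
    (H : ∀ h v, (h, v) ∈ e → c * v ≤ entryMax e' h) (h : ℕ) :
    c * entryMax e h ≤ entryMax e' h := by
  rcases entryMax_eq_zero_or_mem e h with h0 | hm
  · simp [h0]
  · exact H h _ hm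

/-- The least superadditive function on the nodes `h < M` of the binary tree that is at least as
large as the values listed in `e`. -/
def treeClosure (M : ℕ) (e : List (ℕ × ℕ)) (h : ℕ) : ℕ :=
  if h < M then
    max (entryMax e h) (treeClosure M e (2 * h + 1) + treeClosure M e (2 * h + 2))
  else 0
termination_by M - h

theorem treeClosure_of_lt {M h : ℕ} (e : List (ℕ × ℕ)) (hM : h < M) :
    treeClosure M e h =
      max (entryMax e h) (treeClosure M e (2 * h + 1) + treeClosure M e (2 * h + 2)) := by
  rw [treeClosure, if_pos hM]

theorem treeClosure_of_le {M h : ℕ} (e : List (ℕ × ℕ)) (hM : M ≤ h) :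
    treeClosure M e h = 0 := by
  rw [treeClosure, if_neg hM.not_gt]

theorem treeClosure_children_le (M : ℕ) (e : List (ℕ × ℕ)) (h : ℕ) :
    treeClosure M e (2 * h + 1) + treeClosure M e (2 * h + 2) ≤ treeClosure M e h := by
  rcases lt_or_ge h M with hM | hM
  · rw [treeClosure_of_lt e hM]; exact le_max_right _ _
  · rw [treeClosure_of_le e (by omega : M ≤ 2 * h + 1),
      treeClosure_of_le e (by omega : M ≤ 2 * h + 2)]
    exact Nat.zero_le _

theorem le_treeClosure {M h v : ℕ} {e : List (ℕ × ℕ)} (hM : h < M) (hv : (h, v) ∈ e) :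
    v ≤ treeClosure M e h := by
  rw [treeClosure_of_lt e hM]
  exact le_max_of_le_left (le_entryMax hv)

/-- Maxima and sums commute with scaling, so the bound propagates up from the leaves. With `c = 2 ^
(K - k)` this compares closures in units `2⁻ᵏ` and `2⁻ᴷ`; with `c = 1` it is monotonicity. -/
theorem mul_treeClosure_le {c M M' : ℕ} {e e' : List (ℕ × ℕ)} (hM : M ≤ M')
    (H : ∀ h v, (h, v) ∈ e → c * v ≤ entryMax e' h) (h : ℕ) :
    c * treeClosure M e h ≤ treeClosure M' e' h := by
  induction hn : M - h using Nat.strong_induction_on generalizing h with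
  | _ n ih =>
    rcases lt_or_ge h M with hlt | hge
    · rw [treeClosure_of_lt e hlt, treeClosure_of_lt e' (hlt.trans_le hM), ← Nat.mul_max_mul_left,
        mul_add]
      exact max_le_max (mul_entryMax_le H h)
        (add_le_add (ih _ (by omega) _ rfl) (ih _ (by omega) _ rfl))
    · simp [treeClosure_of_le e hge]

/-- Minimality of the closure, by induction from the leaves. Entries below a single semimeasure
therefore never overflow the root. -/
theorem treeClosure_le_of_superadditive {A : List Bool → ℝ} (h0 : ∀ x, 0 ≤ A x)
    (hA : ∀ x, A (x ++ [false]) + A (x ++ [true]) ≤ A x) {e : List (ℕ × ℕ)}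
    (he : ∀ x v, (heapIndex x, v) ∈ e → (v : ℝ) ≤ A x) (M : ℕ) (x : List Bool) :
    (treeClosure M e (heapIndex x) : ℝ) ≤ A x := by
  induction hn : M - heapIndex x using Nat.strong_induction_on generalizing x with
  | _ n ih =>
    rcases lt_or_ge (heapIndex x) M with hlt | hge
    · have hf := ih _ (by rw [heapIndex_concat]; omega) (x ++ [false]) rfl
      have ht := ih _ (by rw [heapIndex_concat]; omega) (x ++ [true]) rfl
      rw [heapIndex_concat] at hf ht
      simp only [Bool.toNat_false, Bool.toNat_true, add_zero] at hf ht
      rw [treeClosure_of_lt e hlt, Nat.cast_max, Nat.cast_add]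
      refine max_le ?_ ((add_le_add hf ht).trans (hA x))
      rcases entryMax_eq_zero_or_mem e (heapIndex x) with hz | hm
      · rw [hz]; exact_mod_cast h0 x
      · exact he x _ hm
    · rw [treeClosure_of_le e hge]; exact_mod_cast h0 x

theorem isTreeSemimeasure_treeClosure {M k : ℕ} {e : List (ℕ × ℕ)}
    (hroot : treeClosure M e 0 ≤ 2 ^ k) :
    IsTreeSemimeasure fun x => (treeClosure M e (heapIndex x) : ℝ) / 2 ^ k where
  nonneg x := by positivity
  root_le_one := by
    rw [heapIndex_nil, div_le_one (by positivity)]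
    exact_mod_cast hroot
  children_le x := by
    rw [← add_div, heapIndex_concat, heapIndex_concat]
    gcongr
    exact_mod_cast treeClosure_children_le M e (heapIndex x)

theorem primrec_entryMax : Primrec₂ entryMax := by
  have hstep : Primrec₂ fun (a : List (ℕ × ℕ) × ℕ) (q : (ℕ × ℕ) × ℕ) =>
      max (if q.1.1 = a.2 then q.1.2 else 0) q.2 := by
    have hq : Primrec fun r : (List (ℕ × ℕ) × ℕ) × (ℕ × ℕ) × ℕ => r.2.1 :=
      Primrec.fst.comp Primrec.snd
    refine Primrec.nat_max.comp (Primrec.ite ?_ (Primrec.snd.comp hq) (Primrec.const 0))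
      (Primrec.snd.comp Primrec.snd)
    exact Primrec.eq.comp (Primrec.fst.comp hq) (Primrec.snd.comp Primrec.fst)
  exact Primrec.list_foldr Primrec.fst (Primrec.const 0) hstep

/-- The values of `treeClosure M e` on the last `m` nodes below `M`. -/
def treeClosureTable (M : ℕ) (e : List (ℕ × ℕ)) (m : ℕ) : List ℕ :=
  Nat.rec [] (fun m L => max (entryMax e (M - (m + 1)))
    (L.getD (M - (m + 1)) 0 + L.getD (M - (m + 1) + 1) 0) :: L) m

theorem treeClosureTable_getD {M m : ℕ} (e : List (ℕ × ℕ)) (hm : m ≤ M) (i : ℕ) :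
    (treeClosureTable M e m).getD i 0 = treeClosure M e (M - m + i) := by
  induction m generalizing i with
  | zero => simp [treeClosureTable, treeClosure_of_le e (Nat.le_add_right M i)]
  | succ m ih =>
    have hcons : treeClosureTable M e (m + 1) = max (entryMax e (M - (m + 1)))
        ((treeClosureTable M e m).getD (M - (m + 1)) 0 +
          (treeClosureTable M e m).getD (M - (m + 1) + 1) 0) :: treeClosureTable M e m := rfl
    rw [hcons]
    cases i with
    | zero =>
      -- With `h = M - (m + 1)`, the previous table starts at node `h + 1`, so the children `2h + 1`
      -- and `2h + 2` occupy positions `h` and `h + 1`.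
      rw [List.getD_cons_zero, ih (by omega), ih (by omega), add_zero,
        treeClosure_of_lt e (by omega : M - (m + 1) < M)]
      congr 3 <;> omega
    | succ i =>
      rw [List.getD_cons_succ, ih (by omega)]
      congr 1; omega

/-- Children have larger indices than their parent, so the recursion can be run by filling a table
downwards from node `M - 1`. -/
theorem primrec_treeClosure :
    Primrec fun p : (ℕ × List (ℕ × ℕ)) × ℕ => treeClosure p.1.1 p.1.2 p.2 := by
  have hget : Primrec₂ fun (L : List ℕ) (n : ℕ) => L.getD n 0 := Primrec.list_getD 0
  have hstep : Primrec₂ fun (a : ℕ × List (ℕ × ℕ)) (q : ℕ × List ℕ) =>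
      max (entryMax a.2 (a.1 - (q.1 + 1)))
        (q.2.getD (a.1 - (q.1 + 1)) 0 + q.2.getD (a.1 - (q.1 + 1) + 1) 0) :: q.2 := by
    have hL : Primrec fun r : (ℕ × List (ℕ × ℕ)) × ℕ × List ℕ => r.2.2 :=
      Primrec.snd.comp Primrec.snd
    have hh : Primrec fun r : (ℕ × List (ℕ × ℕ)) × ℕ × List ℕ => r.1.1 - (r.2.1 + 1) :=
      Primrec.nat_sub.comp (Primrec.fst.comp Primrec.fst)
        (Primrec.succ.comp (Primrec.fst.comp Primrec.snd))
    exact Primrec.list_cons.comp (Primrec.nat_max.comp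
      (primrec_entryMax.comp (Primrec.snd.comp Primrec.fst) hh)
      (Primrec.nat_add.comp (hget.comp hL hh) (hget.comp hL (Primrec.succ.comp hh)))) hL
  have htable : Primrec₂ fun (a : ℕ × List (ℕ × ℕ)) (m : ℕ) => treeClosureTable a.1 a.2 m :=
    Primrec.nat_rec (Primrec.const []) hstep
  refine (hget.comp (htable.comp Primrec.fst (Primrec.fst.comp Primrec.fst)) Primrec.snd).of_eq
    fun p => ?_
  rw [treeClosureTable_getD _ le_rfl]
  simp

theorem computable_treeClosure {α : Type} [Primcodable α] {M h : α → ℕ} {e : α → List (ℕ × ℕ)}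
    (hM : Computable M) (he : Computable e) (hh : Computable h) :
    Computable fun a => treeClosure (M a) (e a) (h a) :=
  Computable.comp (g := fun a => ((M a, e a), h a)) primrec_treeClosure.to_comp
    ((hM.pair he).pair hh)

/-! ### Dyadic rounding -/

theorem primrec_two_pow : Primrec fun n : ℕ => 2 ^ n :=
  (Primrec₂.unpaired'.1 Nat.Primrec.pow).comp (Primrec.const 2) Primrec.id

/-- The integer part of `2 ^ k * (a / b)`. -/
def dyadicFloor (k a b : ℕ) : ℕ := 2 ^ k * a / b

theorem primrec_dyadicFloor :
    Primrec fun p : ℕ × ℕ × ℕ => dyadicFloor p.1 p.2.1 p.2.2 :=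
  Primrec.nat_div.comp (Primrec.nat_mul.comp (primrec_two_pow.comp Primrec.fst)
    (Primrec.fst.comp Primrec.snd)) (Primrec.snd.comp Primrec.snd)

theorem computable_dyadicFloor {α : Type} [Primcodable α] {k a b : α → ℕ}
    (hk : Computable k) (ha : Computable a) (hb : Computable b) :
    Computable fun x => dyadicFloor (k x) (a x) (b x) :=
  Computable.comp (g := fun x => (k x, a x, b x)) primrec_dyadicFloor.to_comp
    (hk.pair (ha.pair hb))

theorem dyadicFloor_le (k a b : ℕ) : (dyadicFloor k a b : ℝ) ≤ 2 ^ k * ((a : ℝ) / b) := by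
  have := Nat.cast_div_le (α := ℝ) (m := 2 ^ k * a) (n := b)
  rw [dyadicFloor]
  calc _ ≤ _ := this
    _ = _ := by push_cast; ring

theorem lt_dyadicFloor_add_one (k a : ℕ) {b : ℕ} (hb : 0 < b) :
    2 ^ k * ((a : ℝ) / b) < dyadicFloor k a b + 1 := by
  have : 2 ^ k * a < (dyadicFloor k a b + 1) * b := by
    rw [mul_comm _ b]; exact Nat.lt_mul_div_succ _ hb
  rw [← mul_div_assoc, div_lt_iff₀ (by exact_mod_cast hb)]
  exact_mod_cast this

/-- Rounding down on a finer grid loses no more; this keeps the approximations monotone across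
stages. -/
theorem two_pow_mul_dyadicFloor_le {k K a b a' b' : ℕ} (hk : k ≤ K) (hb' : 0 < b')
    (h : (a : ℝ) / b ≤ (a' : ℝ) / b') :
    2 ^ (K - k) * dyadicFloor k a b ≤ dyadicFloor K a' b' := by
  rw [dyadicFloor.eq_def K, Nat.le_div_iff_mul_le hb']
  have h1 : (2 : ℝ) ^ (K - k) * dyadicFloor k a b ≤ 2 ^ K * ((a' : ℝ) / b') := by
    calc (2 : ℝ) ^ (K - k) * dyadicFloor k a b ≤ 2 ^ (K - k) * (2 ^ k * ((a : ℝ) / b)) := by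
          gcongr; exact dyadicFloor_le k a b
      _ = 2 ^ K * ((a : ℝ) / b) := by rw [← mul_assoc, ← pow_add, Nat.sub_add_cancel hk]
      _ ≤ _ := by gcongr
  rw [← mul_div_assoc, le_div_iff₀ (by exact_mod_cast hb')] at h1
  exact_mod_cast h1

/-! ### Greedy acceptance of guesses -/

/-- The entries among `E 0, …, E (j - 1)` that are accepted when each entry is accepted as long as
the closure of the accepted entries has value at most `2 ^ n` at the root. -/
def greedyEntries (E : ℕ → ℕ × ℕ) (n j : ℕ) : List (ℕ × ℕ) :=
  Nat.rec [] (fun i e => if treeClosure n (E i :: e) 0 ≤ 2 ^ n then E i :: e else e) j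

section greedyEntries

variable (E : ℕ → ℕ × ℕ) (n : ℕ)

theorem greedyEntries_succ (j : ℕ) :
    greedyEntries E n (j + 1) = if treeClosure n (E j :: greedyEntries E n j) 0 ≤ 2 ^ n then
      E j :: greedyEntries E n j else greedyEntries E n j := rfl

theorem treeClosure_greedyEntries_le (j : ℕ) :
    treeClosure n (greedyEntries E n j) 0 ≤ 2 ^ n := by
  induction j with
  | zero =>
    -- With `c = 2` the closure of the empty list is at least twice itself, hence zero.
    have := mul_treeClosure_le (c := 2) (e := []) (e' := []) (le_refl n) (by simp) 0
    change treeClosure n [] 0 ≤ 2 ^ n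
    exact (by omega : treeClosure n [] 0 ≤ 0).trans (Nat.zero_le _)
  | succ j ih =>
    rw [greedyEntries_succ]
    split_ifs with h
    · exact h
    · exact ih

theorem greedyEntries_subset {i j : ℕ} (hij : i ≤ j) :
    greedyEntries E n i ⊆ greedyEntries E n j := by
  induction hij with
  | refl => exact List.Subset.refl _
  | step _ ih =>
    refine List.Subset.trans ih ?_
    rw [Nat.succ_eq_add_one, greedyEntries_succ]
    split_ifs
    · exact List.subset_cons_self _ _
    · exact List.Subset.refl _

theorem exists_of_mem_greedyEntries {j : ℕ} {p : ℕ × ℕ} (hp : p ∈ greedyEntries E n j) :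
    ∃ i < j, p = E i := by
  induction j with
  | zero => simp [greedyEntries] at hp
  | succ j ih =>
    rw [greedyEntries_succ] at hp
    split_ifs at hp with h
    · rcases List.mem_cons.1 hp with rfl | hp
      · exact ⟨j, j.lt_succ_self, rfl⟩
      · obtain ⟨i, hi, h⟩ := ih hp; exact ⟨i, hi.trans j.lt_succ_self, h⟩
    · obtain ⟨i, hi, h⟩ := ih hp; exact ⟨i, hi.trans j.lt_succ_self, h⟩

variable {E n}

/-- All entries tried so far lie below `A`, so by minimality their closure does too, and the root
test succeeds. Wrong guesses after index `j` are irrelevant. -/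
theorem mem_greedyEntries_succ {A : List Bool → ℝ} (h0 : ∀ x, 0 ≤ A x)
    (hA : ∀ x, A (x ++ [false]) + A (x ++ [true]) ≤ A x) (hroot : A [] ≤ 2 ^ n) {j : ℕ}
    (hE : ∀ i ≤ j, ∀ x, (E i).1 = heapIndex x → ((E i).2 : ℝ) ≤ A x) :
    E j ∈ greedyEntries E n (j + 1) := by
  have : treeClosure n (E j :: greedyEntries E n j) (heapIndex []) ≤ 2 ^ n := by
    have h := treeClosure_le_of_superadditive (e := E j :: greedyEntries E n j) h0 hA ?_ n []
    · exact_mod_cast h.trans hroot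
    · intro x v hv
      obtain ⟨i, hi, h⟩ : ∃ i ≤ j, (heapIndex x, v) = E i := by
        rcases List.mem_cons.1 hv with h | h
        · exact ⟨j, le_rfl, h⟩
        · obtain ⟨i, hi, h⟩ := exists_of_mem_greedyEntries E n h; exact ⟨i, hi.le, h⟩
      have := hE i hi x (by rw [← h])
      rwa [← h] at this
  rw [greedyEntries_succ, if_pos (by simpa using this)]
  exact List.mem_cons_self

end greedyEntries

theorem computable_greedyEntries {E : ℕ → ℕ → ℕ × ℕ} (hE : Computable₂ E) :
    Computable₂ fun n j => greedyEntries (E n) n j := by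
  have hcons : Computable fun r : (ℕ × ℕ) × ℕ × List (ℕ × ℕ) => E r.1.1 r.2.1 :: r.2.2 :=
    Computable.list_cons.comp (hE.comp (Computable.fst.comp Computable.fst)
      (Computable.fst.comp Computable.snd)) (Computable.snd.comp Computable.snd)
  have hn : Computable fun r : (ℕ × ℕ) × ℕ × List (ℕ × ℕ) => r.1.1 :=
    Computable.fst.comp Computable.fst
  have htest : Computable fun r : (ℕ × ℕ) × ℕ × List (ℕ × ℕ) =>
      decide (treeClosure r.1.1 (E r.1.1 r.2.1 :: r.2.2) 0 ≤ 2 ^ r.1.1) :=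
    Primrec.nat_le.decide.to_comp.comp
      (computable_treeClosure hn hcons (Computable.const 0))
      (primrec_two_pow.to_comp.comp hn)
  have hstep : Computable₂ fun (q : ℕ × ℕ) (r : ℕ × List (ℕ × ℕ)) =>
      if treeClosure q.1 (E q.1 r.1 :: r.2) 0 ≤ 2 ^ q.1 then E q.1 r.1 :: r.2 else r.2 :=
    (Computable.cond htest hcons (Computable.snd.comp Computable.snd)).of_eq fun r => by
      by_cases h : treeClosure r.1.1 (E r.1.1 r.2.1 :: r.2.2) 0 ≤ 2 ^ r.1.1 <;> simp [h]
  exact Computable.nat_rec (f := fun q : ℕ × ℕ => q.2) (g := fun _ => [])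
    (h := fun q r => if treeClosure q.1 (E q.1 r.1 :: r.2) 0 ≤ 2 ^ q.1 then E q.1 r.1 :: r.2
      else r.2) Computable.snd (Computable.const []) hstep

/-! ### From `0'`-semicomputable semimeasures to conditional families -/

theorem exists_primrec_enumeration (α : Type) [Primcodable α] [Inhabited α] :
    ∃ s : ℕ → α, Primrec s ∧ Function.Surjective s :=
  ⟨fun j => (Encodable.decode j).getD default, Primrec.option_getD_default.comp Primrec.decode,
    fun a => ⟨Encodable.encode a, by simp⟩⟩

/-- A fraction of an `O`-computable function and an `O`-computable power of two is an
`O`-computable rational function. -/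
theorem ComputableRatIn.div_two_pow {α : Type} [Primcodable α] {O : Set (ℕ →. ℕ)} {u k : α → ℕ}
    (hu : ComputableIn O u) (hk : ComputableIn O k) :
    ComputableRatIn O fun x => (u x : ℚ) / 2 ^ k x := by
  have hd : Primrec fun k : ℕ => 2 ^ k - 1 :=
    Primrec.nat_sub.comp primrec_two_pow (Primrec.const 1)
  refine ⟨u, fun _ => 0, fun x => 2 ^ k x - 1, hu, ComputableIn.const 0,
    hd.computableIn.comp hk, fun x => ?_⟩
  rw [Nat.cast_sub Nat.one_le_two_pow]
  simp

/-- Truncated subtraction replaces negative approximations by `0`. This only raises them, and by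
`natSub_div_le` it does not break nonnegative upper bounds. -/
theorem sub_div_le_natSub_div (u v d : ℕ) :
    ((u : ℝ) - v) / (d + 1) ≤ ((u - v : ℕ) : ℝ) / ((d + 1 : ℕ) : ℝ) := by
  push_cast
  gcongr
  rw [sub_le_iff_le_add]
  exact_mod_cast le_tsub_add

theorem natSub_div_le {u v d : ℕ} {r : ℝ} (h0 : 0 ≤ r) (h : ((u : ℝ) - v) / (d + 1) ≤ r) :
    ((u - v : ℕ) : ℝ) / ((d + 1 : ℕ) : ℝ) ≤ r := by
  rcases le_total v u with huv | huv
  · rw [Nat.cast_sub huv]; push_cast; exact h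
  · rw [Nat.sub_eq_zero_of_le huv]; simpa using h0

/-- Every tree semimeasure that is lower semicomputable in the halting problem is, up to a factor
`2`, eventually dominated by a lower semicomputable family of tree semimeasures. -/
theorem IsLscTreeSemimeasure.exists_cond {a : List Bool → ℝ}
    (ha : IsLscTreeSemimeasure haltingOracle a) :
    ∃ b : List Bool → ℕ → ℝ, IsLscCondTreeSemimeasure b ∧
      ∀ x, 0 < a x → ∀ᶠ n in atTop, a x ≤ 2 * b x n := by
  obtain ⟨hsm, q, ⟨u, v, d, hu, hv, hd, hq⟩, hlim⟩ := ha
  obtain ⟨U, hU, hUl⟩ := hu.exists_limit_approximation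
  obtain ⟨V, hV, hVl⟩ := hv.exists_limit_approximation
  obtain ⟨D, hD, hDl⟩ := hd.exists_limit_approximation
  obtain ⟨s, hs, hsj⟩ := exists_primrec_enumeration (List Bool × ℕ)
  let E : ℕ → ℕ → ℕ × ℕ := fun n j =>
    (heapIndex (s j).1, dyadicFloor n (U (s j) n - V (s j) n) (D (s j) n + 1))
  have hE : Computable₂ E := by
    have hs2 : Computable fun p : ℕ × ℕ => s p.2 := hs.to_comp.comp Computable.snd
    have hUV : Computable fun p : ℕ × ℕ => U (s p.2) p.1 - V (s p.2) p.1 :=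
      Primrec.nat_sub.to_comp.comp (hU.comp hs2 Computable.fst) (hV.comp hs2 Computable.fst)
    have hD1 : Computable fun p : ℕ × ℕ => D (s p.2) p.1 + 1 :=
      Computable.succ.comp (hD.comp hs2 Computable.fst)
    exact Computable.pair (primrec_heapIndex.to_comp.comp (Computable.fst.comp hs2))
      (computable_dyadicFloor Computable.fst hUV hD1)
  refine ⟨fun x n => (treeClosure n (greedyEntries (E n) n n) (heapIndex x) : ℝ) / 2 ^ n,
    ⟨fun n => isTreeSemimeasure_treeClosure (treeClosure_greedyEntries_le _ _ _),
      -- The family is itself rational and computable, so a constant sequence approximates it.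
      fun p _ => (treeClosure p.2 (greedyEntries (E p.2) p.2 p.2) (heapIndex p.1) : ℚ) / 2 ^ p.2,
      ComputableRatIn.div_two_pow (Computable.computableIn ?_) (Computable.computableIn ?_),
      fun p => ⟨monotone_const, ?_⟩⟩, fun x hx => ?_⟩
  · have hn : Computable fun p : (List Bool × ℕ) × ℕ => p.1.2 :=
      Computable.snd.comp Computable.fst
    exact computable_treeClosure hn ((computable_greedyEntries hE).comp hn hn)
      (primrec_heapIndex.to_comp.comp (Computable.fst.comp Computable.fst))
  · exact Computable.snd.comp Computable.fst
  · push_cast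
    exact tendsto_const_nhds
  have hqle : ∀ x k, (q x k : ℝ) ≤ a x := fun x k =>
    Monotone.ge_of_tendsto (Rat.cast_mono.comp (hlim x).1) (hlim x).2 k
  obtain ⟨k, hk⟩ := ((hlim x).2.eventually_const_lt (half_lt_self hx)).exists
  -- The gap between `q x k` and `a x / 2` absorbs the rounding error `2⁻ⁿ`; this is the source of
  -- the factor `2`.
  have hpow : ∀ᶠ n in atTop, ((1 : ℝ) / 2) ^ n < q x k - a x / 2 :=
    (tendsto_pow_atTop_nhds_zero_of_lt_one (by norm_num) (by norm_num)).eventually_lt_const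
      (sub_pos.2 hk)
  obtain ⟨j, hsj⟩ := hsj (x, k)
  -- Earlier guesses must be correct too, since a wrong one could use up the room at the root.
  have hev : ∀ᶠ n in atTop, ∀ i ∈ Finset.range (j + 1),
      U (s i) n = u (s i) ∧ V (s i) n = v (s i) ∧ D (s i) n = d (s i) := by
    rw [Filter.eventually_all_finset]
    intro i _
    filter_upwards [hUl (s i), hVl (s i), hDl (s i)] with n h1 h2 h3 using ⟨h1, h2, h3⟩
  filter_upwards [hpow, hev, eventually_gt_atTop j, eventually_gt_atTop (heapIndex x)]
    with n h1 h2 h3 h4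
  have hqR : ∀ y l, (q y l : ℝ) = ((u (y, l) : ℝ) - v (y, l)) / (d (y, l) + 1) := by
    intro y l
    have := hq (y, l)
    dsimp only at this
    rw [this]; push_cast; rfl
  have hmem : E n j ∈ greedyEntries (E n) n n := by
    refine greedyEntries_subset _ _ (Nat.succ_le_of_lt h3)
      (mem_greedyEntries_succ (A := fun y => 2 ^ n * a y) ?_ ?_ ?_ ?_)
    · intro y; have := hsm.nonneg y; positivity
    · intro y
      rw [← mul_add]
      exact mul_le_mul_of_nonneg_left (hsm.children_le y) (by positivity)
    · simpa using hsm.root_le_one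
    · intro i hi y hy
      obtain ⟨e1, e2, e3⟩ := h2 i (Finset.mem_range.2 (Nat.lt_succ_of_le hi))
      obtain rfl : (s i).1 = y := heapIndex_injective hy
      refine (dyadicFloor_le _ _ _).trans ?_
      gcongr
      rw [e1, e2, e3]
      refine natSub_div_le (hsm.nonneg _) ?_
      exact (hqR (s i).1 (s i).2).symm.trans_le (hqle _ _)
  have hval : 2 ^ n * (q x k : ℝ) < (E n j).2 + 1 := by
    obtain ⟨e1, e2, e3⟩ := h2 j (Finset.mem_range.2 j.lt_succ_self)
    refine lt_of_le_of_lt ?_ (lt_dyadicFloor_add_one _ _ (Nat.succ_pos _))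
    gcongr
    rw [e1, e2, e3, hsj, hqR]
    exact sub_div_le_natSub_div _ _ _
  have hle : (E n j).2 ≤ treeClosure n (greedyEntries (E n) n n) (heapIndex x) := by
    refine le_treeClosure h4 ?_
    have : (E n j).1 = heapIndex x := by simp only [E, hsj]
    rw [← this]
    exact hmem
  have hle' : ((E n j).2 : ℝ) ≤ treeClosure n (greedyEntries (E n) n n) (heapIndex x) := by
    exact_mod_cast hle
  have h2n : (0 : ℝ) < 2 ^ n := by positivity
  rw [← mul_div_assoc, le_div_iff₀ h2n]
  rw [one_div, inv_pow, inv_lt_iff_one_lt_mul₀ h2n] at h1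
  nlinarith

/-! ### Requests granted by `0'` -/

/-- The oracle `0'` decides universal statements with a computable matrix. -/
theorem exists_computableIn_haltingOracle_forall {α : Type} [Primcodable α] {P : α → ℕ → Bool}
    (hP : Computable₂ P) :
    ∃ χ : α → ℕ, ComputableIn haltingOracle χ ∧ ∀ a, χ a = 0 ↔ ∀ w, P a w = true := by
  have hnot : Computable fun p : α × ℕ => !(P p.1 p.2) := Primrec.not.to_comp.comp hP
  have hpart : Partrec fun a => Nat.rfind fun w => Part.some (!(P a w)) :=
    Partrec.rfind (p := fun a w => Part.some (!(P a w))) hnot.partrec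
  obtain ⟨c, hc⟩ := Nat.Partrec.Code.exists_code.1 hpart
  -- The code `c` searches for a counterexample to `P a`; the oracle returns `0` exactly when that
  -- search never halts.
  refine ⟨fun a => haltingFun (Nat.pair (Encodable.encode c) (Encodable.encode a)),
    haltingFun_computableIn.comp (Primrec₂.natPair.comp (Primrec.const _)
      Primrec.encode).computableIn, fun a => ?_⟩
  have hmem : Nat.pair (Encodable.encode c) (Encodable.encode a) ∈ haltingSet ↔
      ∃ w, P a w = false := by
    simp only [haltingSet, Set.mem_ofPred_eq, Nat.unpair_pair, Denumerable.ofNat_encode, hc,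
      Encodable.encodek, Part.coe_some, Part.bind_some]
    change (Nat.rfind fun w => Part.some (!(P a w))).Dom ↔ _
    exact Nat.rfind_dom'.trans (by simp)
  by_cases h : Nat.pair (Encodable.encode c) (Encodable.encode a) ∈ haltingSet
  · obtain ⟨w, hw⟩ := hmem.1 h
    simp only [haltingFun, h, if_true, one_ne_zero, false_iff]
    intro H
    simp [H w] at hw
  · simp only [haltingFun, h, if_false, true_iff]
    intro w
    by_contra hw
    exact h (hmem.2 ⟨w, by simpa using hw⟩)

theorem Computable.range_map {α σ : Type} [Primcodable α] [Primcodable σ] {f : α → ℕ → σ}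
    {g : α → ℕ} (hf : Computable₂ f) (hg : Computable g) :
    Computable fun a => (List.range (g a)).map (f a) := by
  have hstep : Computable₂ fun (a : α) (q : ℕ × List σ) => q.2 ++ [f a q.1] :=
    Computable.list_concat.comp (Computable.snd.comp Computable.snd)
      (hf.comp Computable.fst (Computable.fst.comp Computable.snd))
  refine (Computable.nat_rec hg (Computable.const []) hstep).of_eq fun a => ?_
  induction g a with
  | zero => rfl
  | succ n ih => simp [List.range_succ, ih]

namespace IsTreeSemimeasure

variable {a : List Bool → ℝ}

theorem le_one (ha : IsTreeSemimeasure a) (x : List Bool) : a x ≤ 1 := by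
  induction x using List.reverseRecOn with
  | nil => exact ha.root_le_one
  | append_singleton x b ih =>
    have h := ha.children_le x
    have h0 := ha.nonneg (x ++ [false])
    have h1 := ha.nonneg (x ++ [true])
    cases b <;> linarith

theorem of_tendsto {f : ℕ → List Bool → ℝ} (hf : ∀ k, IsTreeSemimeasure (f k))
    (hlim : ∀ x, Tendsto (fun k => f k x) atTop (𝓝 (a x))) : IsTreeSemimeasure a where
  nonneg x := ge_of_tendsto' (hlim x) fun k => (hf k).nonneg x
  root_le_one := le_of_tendsto' (hlim []) fun k => (hf k).root_le_one
  children_le x := le_of_tendsto_of_tendsto' ((hlim _).add (hlim _)) (hlim x)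
    fun k => (hf k).children_le x

end IsTreeSemimeasure

/-- A request `(x, N, p, b)` asks to raise the value at the string `x` to `p / (b + 1)` for all
conditions `n ≥ N`. -/
abbrev RaiseRequest : Type := List Bool × ℕ × ℕ × ℕ

/-- The entry, in units of `2⁻ᵏ`, by which a request acts at the condition `n`. -/
def RaiseRequest.entry (n k : ℕ) (r : RaiseRequest) : ℕ × ℕ :=
  (heapIndex r.1, if r.2.1 ≤ n then dyadicFloor k r.2.2.1 (r.2.2.2 + 1) else 0)

theorem primrec_map_entry :
    Primrec fun a : List RaiseRequest × ℕ × ℕ => a.1.map (RaiseRequest.entry a.2.1 a.2.2) := by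
  have hr : Primrec fun p : (List RaiseRequest × ℕ × ℕ) × RaiseRequest => p.2 := Primrec.snd
  have hnk : Primrec fun p : (List RaiseRequest × ℕ × ℕ) × RaiseRequest => p.1.2 :=
    Primrec.snd.comp Primrec.fst
  have hN := Primrec.snd.comp hr
  have hp := Primrec.snd.comp hN
  have hval : Primrec fun p : (List RaiseRequest × ℕ × ℕ) × RaiseRequest =>
      dyadicFloor p.1.2.2 p.2.2.2.1 (p.2.2.2.2 + 1) :=
    Primrec.comp (g := fun p : (List RaiseRequest × ℕ × ℕ) × RaiseRequest =>
      (p.1.2.2, p.2.2.2.1, p.2.2.2.2 + 1)) primrec_dyadicFloor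
      ((Primrec.snd.comp hnk).pair ((Primrec.fst.comp hp).pair
        (Primrec.succ.comp (Primrec.snd.comp hp))))
  have hentry : Primrec₂ fun (a : List RaiseRequest × ℕ × ℕ) (r : RaiseRequest) =>
      RaiseRequest.entry a.2.1 a.2.2 r :=
    (primrec_heapIndex.comp (Primrec.fst.comp hr)).pair
      (Primrec.ite (Primrec.nat_le.comp (Primrec.fst.comp hN) (Primrec.fst.comp hnk)) hval
        (Primrec.const 0))
  exact Primrec.list_map Primrec.fst hentry

/-- The requests are granted if they do not raise the root above `1`, for any condition `n`
and any stage `k` of the approximation `Q` of a family of semimeasures. -/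
def Grantable (Q : ℕ → ℕ → List (ℕ × ℕ)) (L : List RaiseRequest) : Prop :=
  ∀ n k, treeClosure k (L.map (RaiseRequest.entry n k) ++ Q n k) 0 ≤ 2 ^ k

open Classical in
/-- The requests among `t 0, …, t (i - 1)` that are granted one after another. -/
noncomputable def grantedRequests (Q : ℕ → ℕ → List (ℕ × ℕ)) (t : ℕ → RaiseRequest) (i : ℕ) :
    List RaiseRequest :=
  Nat.rec [] (fun i L => if Grantable Q (t i :: L) then t i :: L else L) i

section grantedRequests

variable {Q : ℕ → ℕ → List (ℕ × ℕ)} {t : ℕ → RaiseRequest}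

open Classical in
theorem grantedRequests_succ (i : ℕ) : grantedRequests Q t (i + 1) =
    if Grantable Q (t i :: grantedRequests Q t i) then t i :: grantedRequests Q t i
      else grantedRequests Q t i := rfl

theorem grantable_grantedRequests (h0 : Grantable Q []) (i : ℕ) :
    Grantable Q (grantedRequests Q t i) := by
  classical
  induction i with
  | zero => exact h0
  | succ i ih =>
    rw [grantedRequests_succ]
    split_ifs with h
    · exact h
    · exact ih

theorem grantedRequests_subset {i j : ℕ} (hij : i ≤ j) :
    grantedRequests Q t i ⊆ grantedRequests Q t j := by
  classical
  induction hij with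
  | refl => exact List.Subset.refl _
  | step _ ih =>
    refine List.Subset.trans ih ?_
    rw [Nat.succ_eq_add_one, grantedRequests_succ]
    split_ifs
    · exact List.subset_cons_self _ _
    · exact List.Subset.refl _

/-- `Grantable` is a universal statement over coded pairs `(n, k)` with a decidable matrix, because
it tests each finite stage rather than the limit. The oracle thus settles each request. -/
theorem computableIn_grantedRequests (hQ : Computable₂ Q) (ht : Computable t) :
    ComputableIn haltingOracle (grantedRequests Q t) := by
  classical
  have hP : Computable₂ fun (L : List RaiseRequest) (w : ℕ) =>
      decide (treeClosure w.unpair.2 (L.map (RaiseRequest.entry w.unpair.1 w.unpair.2) ++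
        Q w.unpair.1 w.unpair.2) 0 ≤ 2 ^ w.unpair.2) := by
    have hn : Computable fun p : List RaiseRequest × ℕ => p.2.unpair.1 :=
      Computable.fst.comp (Computable.unpair.comp Computable.snd)
    have hk : Computable fun p : List RaiseRequest × ℕ => p.2.unpair.2 :=
      Computable.snd.comp (Computable.unpair.comp Computable.snd)
    have hmap : Computable fun p : List RaiseRequest × ℕ =>
        p.1.map (RaiseRequest.entry p.2.unpair.1 p.2.unpair.2) :=
      Computable.comp (g := fun p : List RaiseRequest × ℕ => (p.1, p.2.unpair.1, p.2.unpair.2))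
        primrec_map_entry.to_comp (Computable.fst.pair (hn.pair hk))
    exact Primrec.nat_le.decide.to_comp.comp
      (computable_treeClosure hk (Computable.list_append.comp hmap (hQ.comp hn hk))
        (Computable.const 0)) (primrec_two_pow.to_comp.comp hk)
  obtain ⟨χ, hχ, hχ0⟩ := exists_computableIn_haltingOracle_forall hP
  have hgrant : ∀ L, χ L = 0 ↔ Grantable Q L := by
    intro L
    rw [hχ0]
    refine ⟨fun h n k => ?_, fun h w => by simpa using h w.unpair.1 w.unpair.2⟩
    simpa using h (Nat.pair n k)
  have hcons : Computable fun q : ℕ × List RaiseRequest => t q.1 :: q.2 :=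
    Computable.list_cons.comp (ht.comp Computable.fst) Computable.snd
  have hsel : Computable fun q : (ℕ × List RaiseRequest) × ℕ =>
      if q.2 = 0 then t q.1.1 :: q.1.2 else q.1.2 := by
    have htest : Computable fun q : (ℕ × List RaiseRequest) × ℕ => decide (q.2 = 0) :=
      (Primrec.eq (α := ℕ)).decide.to_comp.comp Computable.snd (Computable.const 0)
    exact (Computable.cond htest (hcons.comp Computable.fst)
      (Computable.snd.comp Computable.fst)).of_eq fun q => by
        by_cases h : q.2 = 0 <;> simp [h]
  have hstep : ComputableIn haltingOracle fun q : ℕ × List RaiseRequest =>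
      if χ (t q.1 :: q.2) = 0 then t q.1 :: q.2 else q.2 :=
    ComputableIn.comp (g := fun q : ℕ × List RaiseRequest => (q, χ (t q.1 :: q.2)))
      hsel.computableIn (ComputableIn.pair ComputableIn.id (hχ.comp hcons.computableIn))
  have hrec := ComputableIn.nat_rec (a := ([] : List RaiseRequest)) hstep
  convert hrec using 1
  funext i
  induction i with
  | zero => rfl
  | succ i ih => simp only [grantedRequests_succ, ih, hgrant]

end grantedRequests

/-- Raising `n` can only activate the request, and raising `k` only refines its rounding. Hence the
diagonal `n = k` used later is monotone. -/
theorem mul_entry_le {n n' k K : ℕ} (hn : n ≤ n') (hk : k ≤ K) (r : RaiseRequest) :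
    2 ^ (K - k) * (r.entry n k).2 ≤ (r.entry n' K).2 := by
  by_cases h : r.2.1 ≤ n
  · simp only [RaiseRequest.entry, h, h.trans hn, if_true]
    exact two_pow_mul_dyadicFloor_le hk (Nat.succ_pos _) le_rfl
  · simp [RaiseRequest.entry, h]

theorem mul_entry_le_entryMax {n n' k K : ℕ} (hn : n ≤ n') (hk : k ≤ K) {L : List RaiseRequest}
    {h v : ℕ} (hv : (h, v) ∈ L.map (RaiseRequest.entry n k)) {e : List (ℕ × ℕ)}
    (he : L.map (RaiseRequest.entry n' K) ⊆ e) :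
    2 ^ (K - k) * v ≤ entryMax e h := by
  obtain ⟨r, hr, hrv⟩ := List.mem_map.1 hv
  obtain ⟨rfl, rfl⟩ := Prod.ext_iff.1 hrv
  exact (mul_entry_le hn hk r).trans (le_entryMax (he (List.mem_map_of_mem hr)))

/-! ### From conditional families to `0'`-semicomputable semimeasures -/

/-- The limes inferior of a lower semicomputable family of tree semimeasures is bounded by a tree
semimeasure that is lower semicomputable in the halting problem. -/
theorem IsLscCondTreeSemimeasure.exists_le {m : List Bool → ℕ → ℝ}
    (hm : IsLscCondTreeSemimeasure m) :
    ∃ V : List Bool → ℝ, IsLscTreeSemimeasure haltingOracle V ∧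
      ∀ x r, (∀ᶠ n in atTop, r ≤ m x n) → r ≤ V x := by
  obtain ⟨hsm, q, ⟨u, v, d, hu, hv, hd, hq⟩, hlim⟩ := hm
  replace hu := hu.of_empty
  replace hv := hv.of_empty
  replace hd := hd.of_empty
  obtain ⟨s, hs, hs_surj⟩ := exists_primrec_enumeration (List Bool × ℕ)
  obtain ⟨t, ht, ht_surj⟩ := exists_primrec_enumeration RaiseRequest
  -- The `j`-th approximation from below, at the condition `n`, in units of `2⁻ᵏ`.
  let E : ℕ × ℕ → ℕ → ℕ × ℕ := fun a j => (heapIndex (s j).1, dyadicFloor a.2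
    (u (((s j).1, a.1), (s j).2) - v (((s j).1, a.1), (s j).2)) (d (((s j).1, a.1), (s j).2) + 1))
  let Q : ℕ → ℕ → List (ℕ × ℕ) := fun n k => (List.range k).map (E (n, k))
  have hE : Computable₂ E := by
    have hs2 : Computable fun p : (ℕ × ℕ) × ℕ => s p.2 := hs.to_comp.comp Computable.snd
    have harg : Computable fun p : (ℕ × ℕ) × ℕ => (((s p.2).1, p.1.1), (s p.2).2) :=
      ((Computable.fst.comp hs2).pair (Computable.fst.comp Computable.fst)).pair
        (Computable.snd.comp hs2)
    exact Computable.pair (primrec_heapIndex.to_comp.comp (Computable.fst.comp hs2))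
      (computable_dyadicFloor (Computable.snd.comp Computable.fst)
        (Primrec.nat_sub.to_comp.comp (hu.comp harg) (hv.comp harg))
        (Computable.succ.comp (hd.comp harg)))
  have hQ : Computable₂ Q := Computable.range_map hE Computable.snd
  have hqR : ∀ y n l, (q (y, n) l : ℝ) =
      ((u ((y, n), l) : ℝ) - v ((y, n), l)) / (d ((y, n), l) + 1) := by
    intro y n l
    have := hq ((y, n), l)
    dsimp only at this
    rw [this]; push_cast; rfl
  have hqle : ∀ y n l, (q (y, n) l : ℝ) ≤ m y n := fun y n l =>
    Monotone.ge_of_tendsto (Rat.cast_mono.comp (hlim (y, n)).1) (hlim (y, n)).2 l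
  have hQle : ∀ n k h w K, k ≤ K → (h, w) ∈ Q n k → ∀ e, Q n K ⊆ e →
      2 ^ (K - k) * w ≤ entryMax e h := by
    intro n k h w K hk hw e he
    obtain ⟨j, hj, hjw⟩ := List.mem_map.1 hw
    obtain ⟨rfl, rfl⟩ := Prod.ext_iff.1 hjw
    refine (two_pow_mul_dyadicFloor_le hk (Nat.succ_pos _) le_rfl).trans (le_entryMax (he ?_))
    exact List.mem_map.2 ⟨j, List.mem_range.2 ((List.mem_range.1 hj).trans_le hk), rfl⟩
  have hgrant0 : Grantable Q [] := by
    intro n k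
    have h := treeClosure_le_of_superadditive (A := fun y => 2 ^ k * m y n) (e := Q n k)
      (fun y => mul_nonneg (by positivity) ((hsm n).nonneg y)) (fun y => ?_) (fun y w hw => ?_) k []
    · have h1 := h.trans (mul_le_of_le_one_right (by positivity) (hsm n).root_le_one)
      simpa using (by exact_mod_cast h1 : treeClosure k (Q n k) 0 ≤ 2 ^ k)
    · rw [← mul_add]
      exact mul_le_mul_of_nonneg_left ((hsm n).children_le y) (by positivity)
    · obtain ⟨j, -, hjw⟩ := List.mem_map.1 hw
      obtain ⟨hy, rfl⟩ := Prod.ext_iff.1 hjw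
      obtain rfl : (s j).1 = y := heapIndex_injective hy
      refine (dyadicFloor_le _ _ _).trans ?_
      gcongr
      exact natSub_div_le ((hsm n).nonneg _) ((hqR _ _ _).symm.trans_le (hqle _ _ _))
  -- A request strictly below `m` is eventually subsumed by the approximations of `m`. Its closure
  -- at stage `k` is thus dominated, after rescaling, by the closure without it at some later stage
  -- `K`, where grantability of `L` bounds the root.
  have hgrant_cons : ∀ (L : List RaiseRequest) (x : List Bool) (N p b : ℕ),
      Grantable Q L → (∀ n ≥ N, (p : ℝ) / ((b + 1 : ℕ) : ℝ) < m x n) →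
      Grantable Q ((x, N, p, b) :: L) := by
    intro L x N p b hL hlt n k
    obtain ⟨K, hK, hnew⟩ : ∃ K ≥ k, 2 ^ (K - k) * (RaiseRequest.entry n k (x, N, p, b)).2 ≤
        entryMax (L.map (RaiseRequest.entry n K) ++ Q n K) (heapIndex x) := by
      by_cases hn : N ≤ n
      · obtain ⟨l, hl⟩ := ((hlim (x, n)).2.eventually_const_lt (hlt n hn)).exists
        obtain ⟨j, hj⟩ := hs_surj (x, l)
        refine ⟨max k (j + 1), le_max_left _ _, ?_⟩
        simp only [RaiseRequest.entry, hn, if_true]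
        refine (two_pow_mul_dyadicFloor_le (le_max_left _ _) (Nat.succ_pos (d ((x, n), l)))
          (hl.le.trans ((hqR x n l).trans_le (sub_div_le_natSub_div _ _ _)))).trans
          (le_entryMax (List.mem_append_right _ ?_))
        exact List.mem_map.2 ⟨j, List.mem_range.2 (by omega), by simp [E, hj]⟩
      · exact ⟨k, le_rfl, by simp [RaiseRequest.entry, hn]⟩
    have hle : 2 ^ (K - k) *
        treeClosure k (((x, N, p, b) :: L).map (RaiseRequest.entry n k) ++ Q n k) 0 ≤
          treeClosure K (L.map (RaiseRequest.entry n K) ++ Q n K) 0 := by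
      refine mul_treeClosure_le hK (fun h w hw => ?_) 0
      rw [List.map_cons, List.cons_append, List.mem_cons, List.mem_append] at hw
      rcases hw with hw | hw | hw
      · obtain ⟨rfl, rfl⟩ := Prod.ext_iff.1 hw
        exact hnew
      · exact mul_entry_le_entryMax le_rfl hK hw (List.subset_append_left _ _)
      · exact hQle n k h w K hK hw _ (List.subset_append_right _ _)
    have h2 := hle.trans (hL n K)
    rw [← Nat.sub_add_cancel hK, pow_add, Nat.add_sub_cancel] at h2
    exact Nat.le_of_mul_le_mul_left h2 (Nat.two_pow_pos _)
  let A : ℕ → List RaiseRequest := grantedRequests Q t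
  have hA : ComputableIn haltingOracle A := computableIn_grantedRequests hQ ht.to_comp
  -- Stage and condition are both `k`, so each granted request eventually becomes active, while
  -- grantability at `(k, k)` bounds the root.
  let e : ℕ → List (ℕ × ℕ) := fun k => (A k).map (RaiseRequest.entry k k)
  have he : ComputableIn haltingOracle e :=
    ComputableIn.comp (g := fun k => (A k, k, k)) primrec_map_entry.computableIn
      (hA.pair (ComputableIn.id.pair ComputableIn.id))
  let f : ℕ → List Bool → ℝ := fun k x => (treeClosure k (e k) (heapIndex x) : ℝ) / 2 ^ k
  have hf : ∀ k, IsTreeSemimeasure (f k) := fun k => by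
    refine isTreeSemimeasure_treeClosure (le_trans ?_
      (grantable_grantedRequests (t := t) hgrant0 k k k))
    rw [← one_mul (treeClosure k (e k) 0)]
    refine mul_treeClosure_le le_rfl (fun h w hw => ?_) 0
    rw [one_mul]
    exact le_entryMax (List.mem_append_left _ hw)
  have hmono : ∀ x, Monotone fun k => f k x := by
    intro x k K hk
    have hle : 2 ^ (K - k) * treeClosure k (e k) (heapIndex x) ≤
        treeClosure K (e K) (heapIndex x) :=
      mul_treeClosure_le hk (fun h w hw => mul_entry_le_entryMax hk hk hw
        (List.map_subset _ (grantedRequests_subset hk))) _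
    have hle' : (2 : ℝ) ^ (K - k) * treeClosure k (e k) (heapIndex x) ≤
        treeClosure K (e K) (heapIndex x) := by exact_mod_cast hle
    simp only [f]
    rw [div_le_div_iff₀ (by positivity) (by positivity)]
    calc (treeClosure k (e k) (heapIndex x) : ℝ) * 2 ^ K
        = 2 ^ (K - k) * treeClosure k (e k) (heapIndex x) * 2 ^ k := by
          rw [mul_right_comm, ← pow_add, Nat.sub_add_cancel hk, mul_comm]
      _ ≤ _ := by gcongr
  have hbdd : ∀ x, BddAbove (Set.range fun k => f k x) := fun x =>
    ⟨1, by rintro _ ⟨k, rfl⟩; exact (hf k).le_one x⟩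
  have htend : ∀ x, Tendsto (fun k => f k x) atTop (𝓝 (⨆ k, f k x)) := fun x =>
    tendsto_atTop_ciSup (hmono x) (hbdd x)
  have hV : IsTreeSemimeasure fun x => ⨆ k, f k x := IsTreeSemimeasure.of_tendsto hf htend
  refine ⟨fun x => ⨆ k, f k x, ⟨hV,
    fun x k => (treeClosure k (e k) (heapIndex x) : ℚ) / 2 ^ k,
    ComputableRatIn.div_two_pow ?_ ComputableIn.snd, fun x => ⟨?_, ?_⟩⟩, fun x r hr => ?_⟩
  · exact ComputableIn.comp (g := fun p : List Bool × ℕ => ((p.2, e p.2), heapIndex p.1))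
      primrec_treeClosure.computableIn ((ComputableIn.snd.pair (he.comp ComputableIn.snd)).pair
        (primrec_heapIndex.comp Primrec.fst).computableIn)
  · intro k K hk
    have h := hmono x hk
    simp only [f] at h
    rw [← Rat.cast_le (K := ℝ)]
    push_cast
    exact h
  · push_cast
    exact htend x
  by_contra! hlt
  obtain ⟨w, hw1, hw2⟩ := exists_rat_btwn hlt
  have hw0 : 0 < w := by exact_mod_cast (hV.nonneg x).trans_lt hw1
  obtain ⟨N, hN⟩ := eventually_atTop.1 hr
  -- Requests have denominator `b + 1`, whence `w.den - 1`.
  have hw : ((w.num.toNat : ℝ) / ((w.den - 1 + 1 : ℕ) : ℝ)) = w := by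
    rw [Nat.sub_add_cancel w.den_pos, Rat.cast_def w]
    congr 1
    exact_mod_cast Int.toNat_of_nonneg (Rat.num_nonneg.2 hw0.le)
  obtain ⟨i, hi⟩ := ht_surj (x, N, w.num.toNat, w.den - 1)
  have hmem : (x, N, w.num.toNat, w.den - 1) ∈ A (i + 1) := by
    simp only [A]
    rw [grantedRequests_succ, if_pos, hi]
    · exact List.mem_cons_self
    · rw [hi]
      refine hgrant_cons _ _ _ _ _ (grantable_grantedRequests hgrant0 i) fun n hn => ?_
      rw [hw]
      exact hw2.trans_le (hN n hn)
  -- Once granted and active, the request contributes `w` up to the rounding error `2⁻ᵏ`; in the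
  -- limit this contradicts the supremum being below `w`.
  have hge : ∀ᶠ k in atTop, (w : ℝ) - (1 / 2) ^ k ≤ ⨆ k, f k x := by
    filter_upwards [eventually_ge_atTop N, eventually_ge_atTop (i + 1),
      eventually_gt_atTop (heapIndex x)] with k hk1 hk2 hk3
    refine le_trans ?_ (le_ciSup (hbdd x) k)
    have hent : (heapIndex x, dyadicFloor k w.num.toNat (w.den - 1 + 1)) ∈ e k :=
      List.mem_map.2 ⟨_, grantedRequests_subset hk2 hmem, by simp [RaiseRequest.entry, hk1]⟩
    have h1 : (dyadicFloor k w.num.toNat (w.den - 1 + 1) : ℝ) ≤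
        treeClosure k (e k) (heapIndex x) := by exact_mod_cast le_treeClosure hk3 hent
    have h2 := lt_dyadicFloor_add_one k w.num.toNat (Nat.succ_pos (w.den - 1))
    rw [Nat.succ_eq_add_one, hw] at h2
    simp only [f]
    rw [le_div_iff₀ (by positivity), sub_mul, ← mul_pow]
    norm_num
    linarith
  have hlimw : Tendsto (fun k : ℕ => (w : ℝ) - (1 / 2) ^ k) atTop (𝓝 ((w : ℝ) - 0)) :=
    tendsto_const_nhds.sub (tendsto_pow_atTop_nhds_zero_of_lt_one (by norm_num) (by norm_num))
  rw [sub_zero] at hlimw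
  exact (le_of_tendsto hlimw hge).not_gt hw1

/-! ### Passage to complexities -/

theorem negLogTwo_le_add {r s C : ℝ} (hr : 0 < r) (hs : 0 ≤ s) (hC : 0 < C) (h : r ≤ C * s) :
    negLogTwo s ≤ negLogTwo r + (Real.logb 2 C : ℝ) := by
  have hs' : 0 < s := by
    rcases hs.eq_or_lt with rfl | hs
    · simp at h; linarith
    · exact hs
  rw [negLogTwo, negLogTwo, if_neg hs'.ne', if_neg hr.ne', ← EReal.coe_add, EReal.coe_le_coe_iff]
  have h1 := Real.logb_le_logb_of_le (b := 2) (by norm_num) hr h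
  rw [Real.logb_mul hC.ne' hs'.ne'] at h1
  linarith

theorem rpow_neg_le_of_negLogTwo_le {r y : ℝ} (hr : 0 ≤ r) (h : negLogTwo r ≤ y) :
    (2 : ℝ) ^ (-y) ≤ r := by
  rcases hr.eq_or_lt with rfl | hr
  · simp [negLogTwo] at h
  · rw [negLogTwo, if_neg hr.ne', EReal.coe_le_coe_iff] at h
    rw [← Real.le_logb_iff_rpow_le (by norm_num) hr]
    linarith

theorem negLogTwo_rpow_neg (y : ℝ) : negLogTwo ((2 : ℝ) ^ (-y)) = y := by
  rw [negLogTwo, if_neg (by positivity), Real.logb_rpow (by norm_num) (by norm_num), neg_neg]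

theorem theorem5 (m : List Bool → ℕ → ℝ) (m' : List Bool → ℝ)
    (hm : IsMaximalCondTreeSemimeasure m)
    (hm' : IsMaximalTreeSemimeasure haltingOracle m') :
    ∃ c : ℝ, ∀ x : List Bool,
      limsup (fun n : ℕ => KACond m x n) atTop ≤ KA m' x + (c : EReal) ∧
        KA m' x ≤ limsup (fun n : ℕ => KACond m x n) atTop + (c : EReal) := by
  obtain ⟨b, hb, hbm'⟩ := hm'.1.exists_cond
  obtain ⟨C₁, hC₁, hbm⟩ := hm.2 b hb
  obtain ⟨V, hV, hVm⟩ := hm.1.exists_le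
  obtain ⟨C₂, hC₂, hVm'⟩ := hm'.2 V hV
  refine ⟨max (Real.logb 2 (2 * C₁)) (Real.logb 2 C₂), fun x => ⟨?_, ?_⟩⟩
  · rcases (hm'.1.1.nonneg x).eq_or_lt with h0 | hpos
    · rw [KA, ← h0, negLogTwo, if_pos rfl, EReal.top_add_coe]
      exact le_top
    · refine limsup_le_of_le (by isBoundedDefault) ?_
      filter_upwards [hbm' x hpos] with n hn
      refine (negLogTwo_le_add hpos ((hm.1.1 n).nonneg x) (C := 2 * C₁) (by positivity) ?_).trans ?_
      · have := hbm x n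
        linarith
      · exact add_le_add le_rfl (EReal.coe_le_coe_iff.2 (le_max_left _ _))
  · refine le_trans ?_ (add_le_add le_rfl (EReal.coe_le_coe_iff.2 (le_max_right _ _)))
    rw [← EReal.sub_le_iff_le_add (Or.inl (EReal.coe_ne_bot _)) (Or.inl (EReal.coe_ne_top _))]
    -- Testing against real `y` above the limsup also covers the value `⊤`, for which no such `y`
    -- exists.
    refine EReal.le_of_forall_lt_iff_le.1 fun y hy => ?_
    have hev : ∀ᶠ n in atTop, (2 : ℝ) ^ (-y) ≤ m x n := by
      filter_upwards [eventually_lt_of_limsup_lt hy] with n hn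
      exact rpow_neg_le_of_negLogTwo_le ((hm.1.1 n).nonneg x) hn.le
    have hle := (hVm x _ hev).trans (hVm' x)
    rw [EReal.sub_le_iff_le_add (Or.inl (EReal.coe_ne_bot _)) (Or.inl (EReal.coe_ne_top _))]
    have := negLogTwo_le_add (by positivity) (hm'.1.1.nonneg x) hC₂ hle
    rwa [negLogTwo_rpow_neg] at this
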